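/- **Setting.** Let $Q=\mathrm{SE}(3)\times\mathbb R$ with points $(A,c,\alpha)$, where $A\in\mathrm{SO}(3)$ and $c\in\mathbb R^3$. Identify $\mathfrak{se}^*(3)$ with $\mathbb R^3\times\mathbb R^3$ by the dot product. By left trivialization $T^*Q\cong \mathrm{SE}(3)\times\mathfrak{se}^*(3)\times\mathbb R\times\mathbb R^*$, with points $(A,c,\Pi,\Gamma,\alpha,l)$. Let $\omega_Q=-\mathbf d\theta$ be the canonical symplectic form and $\pi_Q:T^*Q\to Q$ the projection. $\mathrm{SE}(3)$ acts on $Q$ by left translation on the first factor, and on $T^*Q$ by $(B,b)\cdot(A,c,\Pi,\Gamma,\alpha,l)=(BA,\,b+Bc,\,\Pi,\Gamma,\alpha,l)$, with momentum map $$\mathbf J_Q(A,c,\Pi,\Gamma,\alpha,l)=(A\Pi+c\times A\Gamma,\;A\Gamma).$$ Let $I_1,I_2,I_3,J_3,g,h>0$, $J_{31},J_{32}\ge0$, let $\chi\in\mathbb R^3$ be a unit vector, and put $\bar I_1=I_1+J_{31}$, $\bar I_2=I_2+J_{32}$, $\bar I_3=I_3$. The Hamiltonian of the rigid spacecraft with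 internal rotor and non-coincident centers of buoyancy and gravity is $$H=\tfrac12\Big[\tfrac{\Pi_1^2}{\bar I_1}+\tfrac{\Pi_2^2}{\bar I_2}+\tfrac{(\Pi_3-l)^2}{\bar I_3}+\tfrac{l^2}{J_3}\Big]+gh\,\Gamma\cdot\chi ,$$ and $X_H$ is its Hamiltonian vector field with respect to $\omega_Q$. Let $(\mu,a)\in\mathfrak{se}^*(3)$, let $\mathcal O_{(\mu,a)}$ be its coadjoint orbit with the orbit symplectic form $\omega^-(\nu)(\operatorname{ad}^*_\xi\nu,\operatorname{ad}^*_\eta\nu)=-\langle\nu,[\xi,\eta]\rangle$, and let $\mathrm{SE}(3)_{(\mu,a)}$ be its isotropy group. The reduced space $\mathcal O_{(\mu,a)}\times\mathbb R\times\mathbb R^*$ carries the sum of $\omega^-$ and the canonical form $\mathbf d\alpha\wedge\mathbf dl$. Let $\pi_{(\mu,a)}:\mathbf J_Q^{-1}(\mu,a)\to\mathcal O_{(\mu,a)}\times\mathbb R\times\mathbb R^*$, $(A,c,\Pi,\Gamma,\alpha,l)\mapsto(\Pi,\Gamma,\alpha,l)$, let $h_{(\mu,a)}$ be the reduced Hamiltonian,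 $h_{(\mu,a)}\circ\pi_{(\mu,a)}=H$, and $X_{h_{(\mu,a)}}$ its Hamiltonian vector field. Let the control torque $u:T^*Q\to T^*Q$ be smooth, fibre-preserving and $\mathrm{SE}(3)$-equivariant with $u(\mathbf J_Q^{-1}(\mu,a))\subset\mathbf J_Q^{-1}(\mu,a)$. The controlled dynamical vector field is $\tilde X=X_H+\mathrm{vlift}(u)X_H$, where $\mathrm{vlift}(u)X_H(z)$ is the vertical part of $Tu(X_H(z))$, with respect to any choice of horizontal subspaces, translated in the fibre from $u(z)$ to $z$. Let $\gamma:Q\to T^*Q$ be a smooth one-form that is $\mathrm{SE}(3)_{(\mu,a)}$-invariant and satisfies $\mathrm{Im}(\gamma)\subset\mathbf J_Q^{-1}(\mu,a)$. Let $\varepsilon:T^*Q\to T^*Q$ be a smooth symplectic map that commutes with the action of $\mathrm{SE}(3)_{(\mu,a)}$ and satisfies $\varepsilon(\mathbf J_Q^{-1}(\mu,a))\subset\mathbf J_Q^{-1}(\mu,a)$. Put $\tilde X^\varepsilon=T\pi_Q\circ\tilde X\circ\varepsilon$, $\bar\gamma=\pi_{(\mu,a)}\circ\gamma$ and $\bar\varepsilon=\pi_{(\mu,a)}\circ\varepsilon$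 (on $\mathbf J_Q^{-1}(\mu,a)$). **Theorem 4.7.** The Type II Hamilton–Jacobi equation $$T\gamma\cdot\tilde X^\varepsilon=X_H\cdot\varepsilon$$ is equivalent to the reduced Type II Hamilton–Jacobi equation $$T\bar\gamma\cdot\tilde X^\varepsilon=X_{h_{(\mu,a)}}\cdot\bar\varepsilon ,$$ in the following two senses (both equations are equalities of tangent vectors, base points included): 1. for every $z\in\mathbf J_Q^{-1}(\mu,a)$, the first equation holds at $z$ if and only if the second holds at $z$; 2. the first equation holds on all of $T^*Q$ if and only if the second holds on all of $\mathbf J_Q^{-1}(\mu,a)$. -/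

import Mathlib

open Matrix Set
open scoped ContDiff

namespace SpacecraftRotor

/-! ### Ambient vector spaces

All manifolds below are embedded submanifolds of one of the following three vector spaces.  A
matrix coordinate is stored as an array of entries and read as a matrix through `Matrix.of`. -/

abbrev Vec3 := Fin 3 → ℝ
abbrev Mat3 := Matrix (Fin 3) (Fin 3) ℝ

/-- Ambient space of the configuration space; coordinates `(A, c, α)`. -/
abbrev ConfAmb := (Fin 3 → Fin 3 → ℝ) × Vec3 × ℝ

/-- Ambient space of the left trivialized phase space; coordinates `(A, c, Π, Γ, α, l)`. -/
abbrev PhaseAmb := (Fin 3 → Fin 3 → ℝ) × Vec3 × Vec3 × Vec3 × ℝ × ℝ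

/-- The space `se(3)* × ℝ × ℝ*`; coordinates `(Π, Γ, α, l)`. -/
abbrev RedAmb := Vec3 × Vec3 × ℝ × ℝ

namespace ConfAmb
abbrev A (q : ConfAmb) : Mat3 := Matrix.of q.1
abbrev c (q : ConfAmb) : Vec3 := q.2.1
abbrev al (q : ConfAmb) : ℝ := q.2.2
end ConfAmb

namespace PhaseAmb
abbrev A (z : PhaseAmb) : Mat3 := Matrix.of z.1
abbrev c (z : PhaseAmb) : Vec3 := z.2.1
abbrev Pi (z : PhaseAmb) : Vec3 := z.2.2.1
abbrev Gam (z : PhaseAmb) : Vec3 := z.2.2.2.1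
abbrev al (z : PhaseAmb) : ℝ := z.2.2.2.2.1
abbrev l (z : PhaseAmb) : ℝ := z.2.2.2.2.2
end PhaseAmb

namespace RedAmb
abbrev Pi (y : RedAmb) : Vec3 := y.1
abbrev Gam (y : RedAmb) : Vec3 := y.2.1
abbrev al (y : RedAmb) : ℝ := y.2.2.1
abbrev l (y : RedAmb) : ℝ := y.2.2.2
end RedAmb

/-! ### Calculus on embedded submanifolds

A map `f` defined on an embedded submanifold `S` of a vector space is smooth if and only if
`ContDiffOn ℝ ∞ f S`.  Derivatives of `f` within `S` at `x` all agree on the vectors tangent to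
`S` at `x`, where they give the tangent map.  A tangent vector is recorded as the pair
(foot point, vector). -/

/-- The tangent map `T f : T S → T F`, `(x, v) ↦ (f x, D f (x) v)`. -/
noncomputable def tmap {E F : Type*} [NormedAddCommGroup E] [NormedSpace ℝ E]
    [NormedAddCommGroup F] [NormedSpace ℝ F] (f : E → F) (S : Set E) (v : E × E) : F × F :=
  (f v.1, fderivWithin ℝ f S v.1 v.2)

/-! ### The Euclidean group and its coadjoint action

The dual of `se(3) = ℝ³ × ℝ³` is identified with `ℝ³ × ℝ³` through the dot product. -/

/-- `SE(3)`: pairs `(A, c)` with `A` a rotation. -/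
def SE3 : Set (Mat3 × Vec3) := {g | g.1 ∈ specialOrthogonalGroup (Fin 3) ℝ}

/-- The Lie bracket of `se(3)`. -/
def bracket (ξ η : Vec3 × Vec3) : Vec3 × Vec3 :=
  (ξ.1 ⨯₃ η.1, ξ.1 ⨯₃ η.2 - η.1 ⨯₃ ξ.2)

/-- The pairing between `se(3)*` and `se(3)`. -/
def pair (ν ξ : Vec3 × Vec3) : ℝ := ν.1 ⬝ᵥ ξ.1 + ν.2 ⬝ᵥ ξ.2

/-- The adjoint action, `Ad_(A,c) (Ω, v) = (A Ω, A v + c × A Ω)`. -/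
def Ad (g : Mat3 × Vec3) (ξ : Vec3 × Vec3) : Vec3 × Vec3 :=
  (g.1 *ᵥ ξ.1, g.1 *ᵥ ξ.2 + g.2 ⨯₃ (g.1 *ᵥ ξ.1))

/-- `Ad*_g`, the transpose of `Ad_g`. -/
def coAd (g : Mat3 × Vec3) (ν : Vec3 × Vec3) : Vec3 × Vec3 :=
  (g.1ᵀ *ᵥ (ν.1 + ν.2 ⨯₃ g.2), g.1ᵀ *ᵥ ν.2)

/-- `ad*_ξ`, the transpose of `ad_ξ`. -/
def coad (ξ ν : Vec3 × Vec3) : Vec3 × Vec3 :=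
  (ν.1 ⨯₃ ξ.1 + ν.2 ⨯₃ ξ.2, ν.2 ⨯₃ ξ.1)

theorem pair_coAd (g : Mat3 × Vec3) (ν ξ : Vec3 × Vec3) :
    pair (coAd g ν) ξ = pair ν (Ad g ξ) := by
  simp [pair, coAd, Ad, dotProduct, mulVec, cross_apply, Fin.sum_univ_three, vecHead, vecTail]
  ring

theorem pair_coad (ξ ν η : Vec3 × Vec3) : pair (coad ξ ν) η = pair ν (bracket ξ η) := by
  simp [pair, coad, bracket, dotProduct, cross_apply, Fin.sum_univ_three]
  ring

/-- The isotropy group `SE(3)_ν` of the coadjoint action. -/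
def isotropy (ν : Vec3 × Vec3) : Set (Mat3 × Vec3) := {g ∈ SE3 | coAd g ν = ν}

/-- The coadjoint orbit `O_ν`. -/
def orbit (ν : Vec3 × Vec3) : Set (Vec3 × Vec3) := {κ | ∃ g ∈ SE3, coAd g ν = κ}

/-! ### Configuration space and phase space -/

/-- `Q = SE(3) × ℝ`. -/
def Q : Set ConfAmb := {q | (q.A, q.c) ∈ SE3}

/-- `T*Q = SE(3) × se(3)* × ℝ × ℝ*` in the left trivialization: `(A, c, Π, Γ, α, l)` stands for
the covector at `(A, c, α)` that sends the velocity `(A Ω̂, A v, s)` to `Π ⬝ Ω + Γ ⬝ v + l s`. -/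
def phaseSpace : Set PhaseAmb := {z | (z.A, z.c) ∈ SE3}

/-- `T_z (T*Q)`, as a space of ambient vectors: `Aᵀ dA` is skew-symmetric. -/
def tangentPhase (z : PhaseAmb) : Set PhaseAmb :=
  {v | (z.Aᵀ * v.A)ᵀ = -(z.Aᵀ * v.A)}

/-- The projection `π_Q : T*Q → Q`. -/
def piQ (z : PhaseAmb) : ConfAmb := (z.1, z.c, z.al)

/-- Left translation on `Q`, trivial on the factor `ℝ`. -/
def actQ (g : Mat3 × Vec3) (q : ConfAmb) : ConfAmb :=
  (Matrix.of.symm (g.1 * q.A), g.2 + g.1 *ᵥ q.c, q.al)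

/-- The cotangent lift of left translation. -/
def act (g : Mat3 × Vec3) (z : PhaseAmb) : PhaseAmb :=
  (Matrix.of.symm (g.1 * z.A), g.2 + g.1 *ᵥ z.c, z.Pi, z.Gam, z.al, z.l)

/-- The vector `Ω` of a skew-symmetric matrix `Ω̂` (where `Ω̂ x = Ω × x`). -/
noncomputable def vee (M : Mat3) : Vec3 :=
  ![(M 2 1 - M 1 2) / 2, (M 0 2 - M 2 0) / 2, (M 1 0 - M 0 1) / 2]

/-- The canonical one-form of `T*Q`: the covector `z` applied to `T π_Q (v)`. -/
noncomputable def canonicalOneForm (z v : PhaseAmb) : ℝ :=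
  z.Pi ⬝ᵥ vee (z.Aᵀ * v.A) + z.Gam ⬝ᵥ (z.Aᵀ *ᵥ v.c) + z.l * v.al

/-- The canonical symplectic form `ω_Q = -d θ` of `T*Q`, with `θ` the canonical one-form. -/
noncomputable def canonicalForm (z v w : PhaseAmb) : ℝ :=
  fderiv ℝ (fun x => canonicalOneForm x v) z w - fderiv ℝ (fun x => canonicalOneForm x w) z v

/-- `X` is the Hamiltonian vector field of `H` on `(T*Q, ω_Q)`: `i_X ω_Q = dH`. -/
def IsHamiltonianField (H : PhaseAmb → ℝ) (X : PhaseAmb → PhaseAmb) : Prop :=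
  ∀ z ∈ phaseSpace, X z ∈ tangentPhase z ∧
    ∀ w ∈ tangentPhase z, canonicalForm z (X z) w = fderivWithin ℝ H phaseSpace z w

/-- The momentum map `J_Q : T*Q → se(3)*` of the lifted left action,
`J_Q (A, c, Π, Γ, α, l) = Ad*_(A,c)⁻¹ (Π, Γ)`. -/
def momentumMap (z : PhaseAmb) : Vec3 × Vec3 :=
  (z.A *ᵥ z.Pi + z.c ⨯₃ (z.A *ᵥ z.Gam), z.A *ᵥ z.Gam)

/-- The level set `J_Q⁻¹ (ν)`. -/
def level (ν : Vec3 × Vec3) : Set PhaseAmb := {z ∈ phaseSpace | momentumMap z = ν}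

/-! ### The reduced space -/

/-- The reduced space `O_ν × ℝ × ℝ*`. -/
def reducedSpace (ν : Vec3 × Vec3) : Set RedAmb := {y | (y.Pi, y.Gam) ∈ orbit ν}

/-- The tangent space of `O_ν × ℝ × ℝ*` at `y`. -/
def tangentReduced (y : RedAmb) : Set RedAmb :=
  {w | ∃ ξ : Vec3 × Vec3, coad ξ (y.Pi, y.Gam) = (w.Pi, w.Gam)}

/-- The reduction projection `J_Q⁻¹ (ν) → O_ν × ℝ × ℝ*`. -/
def piRed (z : PhaseAmb) : RedAmb := (z.Pi, z.Gam, z.al, z.l)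

/-- Some `ξ` with `ad*_ξ κ = u`, for `u` tangent at `κ` to the coadjoint orbit of `κ`. -/
noncomputable def generator (κ u : Vec3 × Vec3) : Vec3 × Vec3 :=
  Classical.epsilon fun ξ => coad ξ κ = u

/-- The orbit symplectic form with the minus sign:
`ω⁻ (κ) (ad*_ξ κ, ad*_η κ) = -⟨κ, [ξ, η]⟩`. -/
noncomputable def orbitForm (κ u w : Vec3 × Vec3) : ℝ :=
  -pair κ (bracket (generator κ u) (generator κ w))

theorem orbitForm_coad (κ ξ η : Vec3 × Vec3) :
    orbitForm κ (coad ξ κ) (coad η κ) = -pair κ (bracket ξ η) := by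
  have h1 : coad (generator κ (coad ξ κ)) κ = coad ξ κ :=
    Classical.epsilon_spec (p := fun ζ => coad ζ κ = coad ξ κ) ⟨ξ, rfl⟩
  have h2 : coad (generator κ (coad η κ)) κ = coad η κ :=
    Classical.epsilon_spec (p := fun ζ => coad ζ κ = coad η κ) ⟨η, rfl⟩
  have anti : ∀ a b, pair κ (bracket a b) = -pair κ (bracket b a) := by
    intro a b
    simp [pair, bracket, dotProduct, cross_apply, Fin.sum_univ_three]
    ring
  rw [orbitForm, ← pair_coad, h1, pair_coad, anti ξ, ← pair_coad, h2, pair_coad, anti ξ]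

/-- The symplectic form `π_O^* ω⁻ + π_ℝ^* ω_ℝ` of `O_ν × ℝ × ℝ*`. -/
noncomputable def reducedForm (y v w : RedAmb) : ℝ :=
  orbitForm (y.Pi, y.Gam) (v.Pi, v.Gam) (w.Pi, w.Gam) + (w.l * v.al - v.l * w.al)

/-- `X` is the Hamiltonian vector field of `h` on `O_ν × ℝ × ℝ*`. -/
def IsReducedHamiltonianField (ν : Vec3 × Vec3) (h : RedAmb → ℝ) (X : RedAmb → RedAmb) : Prop :=
  ∀ y ∈ reducedSpace ν, X y ∈ tangentReduced y ∧
    ∀ w ∈ tangentReduced y, reducedForm y (X y) w = fderivWithin ℝ h (reducedSpace ν) y w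

/-! ### The Hamiltonian -/

/-- The physical constants of the spacecraft with rotor. -/
structure Params where
  I₁ : ℝ
  I₂ : ℝ
  I₃ : ℝ
  J₃₁ : ℝ
  J₃₂ : ℝ
  J₃ : ℝ
  g : ℝ
  h : ℝ
  χ : Vec3
  I₁_pos : 0 < I₁
  I₂_pos : 0 < I₂
  I₃_pos : 0 < I₃
  J₃₁_nonneg : 0 ≤ J₃₁
  J₃₂_nonneg : 0 ≤ J₃₂
  J₃_pos : 0 < J₃
  g_pos : 0 < g
  h_pos : 0 < h
  χ_unit : χ ⬝ᵥ χ = 1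

/-- The Hamiltonian on `T*Q`, with `Ī₁ = I₁ + J₃₁`, `Ī₂ = I₂ + J₃₂`, `Ī₃ = I₃`. -/
noncomputable def hamiltonian (p : Params) (z : PhaseAmb) : ℝ :=
  (1 / 2) * (z.Pi 0 ^ 2 / (p.I₁ + p.J₃₁) + z.Pi 1 ^ 2 / (p.I₂ + p.J₃₂)
    + (z.Pi 2 - z.l) ^ 2 / p.I₃ + z.l ^ 2 / p.J₃) + p.g * p.h * (z.Gam ⬝ᵥ p.χ)

/-- The reduced Hamiltonian on `O_ν × ℝ × ℝ*`. -/
noncomputable def reducedHamiltonian (p : Params) (y : RedAmb) : ℝ :=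
  (1 / 2) * (y.Pi 0 ^ 2 / (p.I₁ + p.J₃₁) + y.Pi 1 ^ 2 / (p.I₂ + p.J₃₂)
    + (y.Pi 2 - y.l) ^ 2 / p.I₃ + y.l ^ 2 / p.J₃) + p.g * p.h * (y.Gam ⬝ᵥ p.χ)

theorem reducedHamiltonian_piRed (p : Params) (z : PhaseAmb) :
    reducedHamiltonian p (piRed z) = hamiltonian p z := rfl

/-! ### Controls -/

/-- The kernel of `T π_Q` at a point of `T*Q`. -/
def vertical : Set PhaseAmb := {v | piQ v = 0}

/-- `K z` is a projection of `T_z (T*Q)` onto the vertical space, that is, the vertical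
projection along a choice of horizontal spaces (a connection on `π_Q`). -/
def IsVerticalProjection (K : PhaseAmb → PhaseAmb →ₗ[ℝ] PhaseAmb) : Prop :=
  ∀ z ∈ phaseSpace, (∀ v ∈ tangentPhase z, K z v ∈ vertical) ∧ ∀ v ∈ vertical, K z v = v

/-- A control torque of the system that is reducible at `ν`: a smooth fibre-preserving map
`u : T*Q → T*Q` that is invariant under the lifted action and maps `J_Q⁻¹ (ν)` into itself. -/
structure IsReducibleControl (ν : Vec3 × Vec3) (u : PhaseAmb → PhaseAmb) : Prop where
  smooth : ContDiffOn ℝ ∞ u phaseSpace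
  fibre : ∀ z ∈ phaseSpace, piQ (u z) = piQ z
  invariant : ∀ g ∈ SE3, ∀ z ∈ phaseSpace, u (act g z) = act g (u z)
  mapsLevel : MapsTo u (level ν) (level ν)

/-- `vlift(u) X` at `z`: the vertical part of `T u (X z)`, a vertical vector at `u z`, moved to
`z` by translation in the fibre (which leaves its ambient coordinates unchanged). -/
noncomputable def vlift (K : PhaseAmb → PhaseAmb →ₗ[ℝ] PhaseAmb) (u X : PhaseAmb → PhaseAmb)
    (z : PhaseAmb) : PhaseAmb :=
  K (u z) (tmap u phaseSpace (z, X z)).2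

/-- The dynamical vector field `X̃ = X_H + vlift(u) X_H` of the controlled system. -/
noncomputable def controlledField (K : PhaseAmb → PhaseAmb →ₗ[ℝ] PhaseAmb)
    (u X : PhaseAmb → PhaseAmb) (z : PhaseAmb) : PhaseAmb :=
  X z + vlift K u X z

/-! ### One-forms, symplectic maps and the Hamilton–Jacobi equations -/

/-- A smooth one-form on `Q`, as a section `Q → T*Q`, with image in `J_Q⁻¹ (ν)` and invariant
under `SE(3)_ν`. -/
structure IsReducibleOneForm (ν : Vec3 × Vec3) (γ : ConfAmb → PhaseAmb) : Prop where
  smooth : ContDiffOn ℝ ∞ γ Q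
  isSection : ∀ q ∈ Q, piQ (γ q) = q
  mapsLevel : MapsTo γ Q (level ν)
  invariant : ∀ g ∈ isotropy ν, ∀ q ∈ Q, γ (actQ g q) = act g (γ q)

/-- A smooth symplectic map `T*Q → T*Q` that commutes with the action of `SE(3)_ν` and maps
`J_Q⁻¹ (ν)` into itself. -/
structure IsReducibleSymplecticMap (ν : Vec3 × Vec3) (ε : PhaseAmb → PhaseAmb) : Prop where
  smooth : ContDiffOn ℝ ∞ ε phaseSpace
  mapsTo : MapsTo ε phaseSpace phaseSpace
  symplectic : ∀ z ∈ phaseSpace, ∀ v ∈ tangentPhase z, ∀ w ∈ tangentPhase z,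
    canonicalForm (ε z) (tmap ε phaseSpace (z, v)).2 (tmap ε phaseSpace (z, w)).2
      = canonicalForm z v w
  invariant : ∀ g ∈ isotropy ν, ∀ z ∈ phaseSpace, ε (act g z) = act g (ε z)
  mapsLevel : MapsTo ε (level ν) (level ν)

/-- `X̃^ε = T π_Q ∘ X̃ ∘ ε : T*Q → TQ`. -/
noncomputable def configField (X : PhaseAmb → PhaseAmb) (ε : PhaseAmb → PhaseAmb)
    (z : PhaseAmb) : ConfAmb × ConfAmb :=
  tmap piQ phaseSpace (ε z, X (ε z))

/-- The Type II Hamilton–Jacobi equation `T γ ∘ X̃^ε = X_H ∘ ε` at the point `z`, an equality of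
tangent vectors to `T*Q` (foot points included). -/
def TypeIIAt (XH Xt : PhaseAmb → PhaseAmb) (γ : ConfAmb → PhaseAmb) (ε : PhaseAmb → PhaseAmb)
    (z : PhaseAmb) : Prop :=
  tmap γ Q (configField Xt ε z) = (ε z, XH (ε z))

/-- The reduced Type II Hamilton–Jacobi equation `T γ̄ ∘ X̃^ε = X_h ∘ ε̄` at the point `z`, with
`γ̄ = π ∘ γ` and `ε̄ = π ∘ ε`, an equality of tangent vectors to `O_ν × ℝ × ℝ*`. -/
def ReducedTypeIIAt (Xh : RedAmb → RedAmb) (Xt : PhaseAmb → PhaseAmb) (γ : ConfAmb → PhaseAmb)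
    (ε : PhaseAmb → PhaseAmb) (z : PhaseAmb) : Prop :=
  tmap (piRed ∘ γ) Q (configField Xt ε z) = ((piRed ∘ ε) z, Xh ((piRed ∘ ε) z))

end SpacecraftRotor

open SpacecraftRotor

/-!
Everything is computed in the left trivialization. There the canonical form is
`ω((ξ, κ'), (η, λ')) = ⟨λ', ξ⟩ - ⟨κ', η⟩ + ⟨κ, [ξ, η]⟩`, plus the rotor term
(`canonicalForm_leftVec`). As `H` factors through the reduction projection, `X_H` is related by
this projection to the reduced field (`reducedField_piRed`): both have orbit component `ad*_ξ κ`,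
with `ξ` the base component of `X_H`.

The equivalence at a point `z` of the level set (`typeIIAt_iff_reducedTypeIIAt`) comes from
splitting a tangent vector of `T*Q` into its images under `π_Q` and under the reduction projection,
which determine it together. The vertical lift of the control does not change the base component,
so `X̃^ε(z)` is `T π_Q` of `X_H(ε z)`. Since `γ` is a section, the images under `π_Q` of the two
sides of the first equation always agree, and the images under the reduction projection agree
exactly when the reduced equation holds.

For the global equivalence, the first equation on `T*Q` restricts to the level set. Conversely,
the foot points of the reduced equation on the whole level set would give `ε = γ ∘ π_Q ∘ ε` there.
That is impossible for reasons of dimension (`exists_level_section_ne`): the level set has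
dimension `8`, the image of `γ` has dimension `7`, and a symplectic map is an immersion. So
neither equation holds on its whole domain, and the content of the theorem is pointwise.

Tangent vectors are handled as velocities of curves, because the embedded submanifolds of the
ambient vector spaces are not sets of unique differentiability.
-/

namespace SpacecraftRotor

/-! ### Velocities of curves and derivatives within a set -/

section Velocity

variable {E F G : Type*} [NormedAddCommGroup E] [NormedSpace ℝ E]
  [NormedAddCommGroup F] [NormedSpace ℝ F] [NormedAddCommGroup G] [NormedSpace ℝ G]

/-- `v` is the velocity at time `0` of a curve through `x` that stays in `S`. -/
def IsVelocity (S : Set E) (x v : E) : Prop :=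
  ∃ c : ℝ → E, c 0 = x ∧ HasDerivAt c v 0 ∧ ∀ t, c t ∈ S

theorem IsVelocity.map {S : Set E} {T : Set F} {x v : E} (hv : IsVelocity S x v) {f : E → F}
    {f' : E →L[ℝ] F} (hf : HasFDerivWithinAt f f' S x) (hST : MapsTo f S T) :
    IsVelocity T (f x) (f' v) := by
  obtain ⟨c, h0, hc, hS⟩ := hv
  refine ⟨f ∘ c, by simp [h0], ?_, fun t => hST (hS t)⟩
  have h := hf.comp_hasDerivWithinAt_of_eq (s := univ) (0 : ℝ) hc.hasDerivWithinAt
    (fun t _ => hS t) h0.symm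
  simpa using h

/-- Derivatives within a set are determined on the velocities of its curves, although the set
need not be a set of unique differentiability. -/
theorem IsVelocity.fderiv_unique {S : Set E} {x v : E} (hv : IsVelocity S x v) {f : E → F}
    {f₁ f₂ : E →L[ℝ] F} (h₁ : HasFDerivWithinAt f f₁ S x) (h₂ : HasFDerivWithinAt f f₂ S x) :
    f₁ v = f₂ v := by
  obtain ⟨c, h0, hc, hS⟩ := hv
  have e₁ := h₁.comp_hasDerivWithinAt_of_eq (s := univ) (0 : ℝ) hc.hasDerivWithinAt
    (fun t _ => hS t) h0.symm
  have e₂ := h₂.comp_hasDerivWithinAt_of_eq (s := univ) (0 : ℝ) hc.hasDerivWithinAt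
    (fun t _ => hS t) h0.symm
  rw [hasDerivWithinAt_univ] at e₁ e₂
  exact e₁.unique e₂

theorem IsVelocity.fderivWithin_apply {S : Set E} {x v : E} (hv : IsVelocity S x v) {f : E → F}
    {f' : E →L[ℝ] F} (h : HasFDerivWithinAt f f' S x) : fderivWithin ℝ f S x v = f' v :=
  hv.fderiv_unique h.differentiableWithinAt.hasFDerivWithinAt h

theorem hasDerivAt_add_smul (x v : E) : HasDerivAt (fun t : ℝ => x + t • v) v 0 := by
  simpa using ((hasDerivAt_id (0 : ℝ)).smul_const v).const_add x

end Velocity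

/-! ### Rotations and skew-symmetric matrices -/

/-- The skew-symmetric matrix `Ω̂` with `Ω̂ x = Ω × x`. -/
def hat (Ω : Vec3) : Mat3 := !![0, -Ω 2, Ω 1; Ω 2, 0, -Ω 0; -Ω 1, Ω 0, 0]

theorem vee_hat (Ω : Vec3) : vee (hat Ω) = Ω := by
  ext i; fin_cases i <;> simp [vee, hat]

theorem hat_zero : hat 0 = 0 := by
  ext i j; fin_cases i <;> fin_cases j <;> simp [hat]

theorem hat_mulVec (Ω x : Vec3) : hat Ω *ᵥ x = Ω ⨯₃ x := by
  ext i; fin_cases i <;> simp [hat, cross_apply, mulVec, dotProduct, Fin.sum_univ_three] <;> ring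

theorem hat_transpose (Ω : Vec3) : (hat Ω)ᵀ = -hat Ω := by
  ext i j; fin_cases i <;> fin_cases j <;> simp [hat]

theorem hat_vee {M : Mat3} (hM : Mᵀ = -M) : hat (vee M) = M := by
  have h : ∀ i j, M j i = -M i j := fun i j => congrFun (congrFun hM i) j
  have h00 := h 0 0
  have h11 := h 1 1
  have h22 := h 2 2
  have h01 := h 0 1
  have h02 := h 0 2
  have h12 := h 1 2
  ext i j; fin_cases i <;> fin_cases j <;> simp [hat, vee] <;> linarith

/-- A curve of rotations through `1` with velocity `Ω̂`: the product of the rotations about the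
three coordinate axes by the angles `t Ω i`. -/
noncomputable def rot (Ω : Vec3) (t : ℝ) : Mat3 :=
  !![1, 0, 0; 0, Real.cos (t * Ω 0), -Real.sin (t * Ω 0);
      0, Real.sin (t * Ω 0), Real.cos (t * Ω 0)] *
    (!![Real.cos (t * Ω 1), 0, Real.sin (t * Ω 1); 0, 1, 0;
      -Real.sin (t * Ω 1), 0, Real.cos (t * Ω 1)] *
    !![Real.cos (t * Ω 2), -Real.sin (t * Ω 2), 0;
      Real.sin (t * Ω 2), Real.cos (t * Ω 2), 0; 0, 0, 1])

theorem rot_mem (Ω : Vec3) (t : ℝ) : rot Ω t ∈ specialOrthogonalGroup (Fin 3) ℝ := by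
  refine mul_mem ?_ (mul_mem ?_ ?_) <;>
  · rw [mem_specialOrthogonalGroup_iff, mem_orthogonalGroup_iff]
    constructor
    · ext i j
      fin_cases i <;> fin_cases j <;>
        simp [Matrix.mul_apply, Fin.sum_univ_three, ← sq] <;> ring
    · simp [det_fin_three, ← sq]

theorem rot_zero (Ω : Vec3) : rot Ω 0 = 1 := by
  ext i j
  fin_cases i <;> fin_cases j <;> simp [rot, Matrix.mul_apply, Fin.sum_univ_three]

theorem hasDerivAt_matrix_mul {M N : ℝ → Mat3} {M' N' : Mat3} {t : ℝ}
    (hM : ∀ i j, HasDerivAt (fun s => M s i j) (M' i j) t)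
    (hN : ∀ i j, HasDerivAt (fun s => N s i j) (N' i j) t) (i j : Fin 3) :
    HasDerivAt (fun s => (M s * N s) i j) ((M' * N t + M t * N') i j) t := by
  simp only [Matrix.mul_apply, Matrix.add_apply, ← Finset.sum_add_distrib]
  exact HasDerivAt.fun_sum fun k _ => (hM i k).fun_mul (hN k j)

theorem hasDerivAt_rot (Ω : Vec3) (i j : Fin 3) :
    HasDerivAt (fun t => rot Ω t i j) (hat Ω i j) 0 := by
  have hc : ∀ k, HasDerivAt (fun t : ℝ => Real.cos (t * Ω k)) 0 0 := fun k => by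
    simpa using ((hasDerivAt_id (0 : ℝ)).mul_const (Ω k)).cos
  have hs : ∀ k, HasDerivAt (fun t : ℝ => Real.sin (t * Ω k)) (Ω k) 0 := fun k => by
    simpa using ((hasDerivAt_id (0 : ℝ)).mul_const (Ω k)).sin
  have hX : ∀ i j, HasDerivAt (fun t : ℝ => (!![1, 0, 0; 0, Real.cos (t * Ω 0),
      -Real.sin (t * Ω 0); 0, Real.sin (t * Ω 0), Real.cos (t * Ω 0)] : Mat3) i j)
      ((!![0, 0, 0; 0, 0, -Ω 0; 0, Ω 0, 0] : Mat3) i j) 0 := by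
    intro i j
    fin_cases i <;> fin_cases j <;>
      simp [hasDerivAt_const, hc, hs, (hs 0).fun_neg]
  have hY : ∀ i j, HasDerivAt (fun t : ℝ => (!![Real.cos (t * Ω 1), 0, Real.sin (t * Ω 1);
      0, 1, 0; -Real.sin (t * Ω 1), 0, Real.cos (t * Ω 1)] : Mat3) i j)
      ((!![0, 0, Ω 1; 0, 0, 0; -Ω 1, 0, 0] : Mat3) i j) 0 := by
    intro i j
    fin_cases i <;> fin_cases j <;>
      simp [hasDerivAt_const, hc, hs, (hs 1).fun_neg]
  have hZ : ∀ i j, HasDerivAt (fun t : ℝ => (!![Real.cos (t * Ω 2), -Real.sin (t * Ω 2), 0;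
      Real.sin (t * Ω 2), Real.cos (t * Ω 2), 0; 0, 0, 1] : Mat3) i j)
      ((!![0, -Ω 2, 0; Ω 2, 0, 0; 0, 0, 0] : Mat3) i j) 0 := by
    intro i j
    fin_cases i <;> fin_cases j <;>
      simp [hasDerivAt_const, hc, hs, (hs 2).fun_neg]
  have h := hasDerivAt_matrix_mul hX (hasDerivAt_matrix_mul hY hZ) i j
  refine HasDerivAt.congr_deriv h ?_
  fin_cases i <;> fin_cases j <;> simp [hat]

theorem hasDerivAt_matrix_mulVec {M : ℝ → Mat3} {x : ℝ → Vec3} {M' : Mat3} {x' : Vec3} {t : ℝ}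
    (hM : ∀ i j, HasDerivAt (fun s => M s i j) (M' i j) t) (hx : HasDerivAt x x' t) :
    HasDerivAt (fun s => M s *ᵥ x s) (M' *ᵥ x t + M t *ᵥ x') t := by
  rw [hasDerivAt_pi] at hx ⊢
  intro i
  simp only [mulVec, dotProduct, Pi.add_apply, ← Finset.sum_add_distrib]
  exact HasDerivAt.fun_sum fun k _ => (hM i k).fun_mul (hx k)

theorem hasDerivAt_mul_rot (A : Mat3) (Ω : Vec3) :
    HasDerivAt (fun t => Matrix.of.symm (A * rot Ω t)) (Matrix.of.symm (A * hat Ω)) 0 := by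
  refine hasDerivAt_pi.2 fun i => hasDerivAt_pi.2 fun j => ?_
  have h := hasDerivAt_matrix_mul (M := fun _ => A) (M' := 0)
    (fun i j => by simpa using hasDerivAt_const (0 : ℝ) (A i j)) (hasDerivAt_rot Ω) i j
  simpa using h

/-! ### Tangent vectors of the phase space in the left trivialization -/

theorem transpose_mul_self {A : Mat3} (hA : A ∈ specialOrthogonalGroup (Fin 3) ℝ) : Aᵀ * A = 1 := by
  have h := (mem_specialOrthogonalGroup_iff.1 hA).1
  rw [mem_orthogonalGroup_iff'] at h
  simpa [star_eq_conjTranspose] using h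

theorem self_mul_transpose {A : Mat3} (hA : A ∈ specialOrthogonalGroup (Fin 3) ℝ) : A * Aᵀ = 1 :=
  mul_eq_one_comm.1 (transpose_mul_self hA)

/-- The tangent vector at `z` with left trivialized velocity `(Ω, V)` in `se(3)` and remaining
components `(P, G, s, m)`. -/
def leftVec (z : PhaseAmb) (Ω V P G : Vec3) (s m : ℝ) : PhaseAmb :=
  (Matrix.of.symm (z.A * hat Ω), z.A *ᵥ V, P, G, s, m)

theorem exists_eq_leftVec {z v : PhaseAmb} (hz : z ∈ phaseSpace) (hv : v ∈ tangentPhase z) :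
    ∃ Ω V, v = leftVec z Ω V v.Pi v.Gam v.al v.l := by
  refine ⟨vee (z.Aᵀ * v.A), z.Aᵀ *ᵥ v.c, ?_⟩
  have h1 : z.A * (z.Aᵀ * v.A) = v.A := by
    rw [← Matrix.mul_assoc, self_mul_transpose hz, Matrix.one_mul]
  have h2 : z.A *ᵥ (z.Aᵀ *ᵥ v.c) = v.c := by
    rw [mulVec_mulVec, self_mul_transpose hz, one_mulVec]
  rw [leftVec, hat_vee hv, h1, h2]
  rfl

theorem leftVec_mem_tangentPhase {z : PhaseAmb} (hz : z ∈ phaseSpace) (Ω V P G : Vec3) (s m : ℝ) :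
    leftVec z Ω V P G s m ∈ tangentPhase z := by
  change (z.Aᵀ * (z.A * hat Ω))ᵀ = -(z.Aᵀ * (z.A * hat Ω))
  rw [← Matrix.mul_assoc, transpose_mul_self hz, Matrix.one_mul, hat_transpose]

theorem isVelocity_leftVec {z : PhaseAmb} (hz : z ∈ phaseSpace) (Ω V P G : Vec3) (s m : ℝ) :
    IsVelocity phaseSpace z (leftVec z Ω V P G s m) := by
  refine ⟨fun t => (Matrix.of.symm (z.A * rot Ω t), z.c + t • (z.A *ᵥ V), z.Pi + t • P,
    z.Gam + t • G, z.al + t • s, z.l + t • m), ?_, ?_, fun t => mul_mem hz (rot_mem Ω t)⟩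
  · simp [rot_zero]
  · exact (hasDerivAt_mul_rot z.A Ω).prodMk ((hasDerivAt_add_smul _ _).prodMk
      ((hasDerivAt_add_smul _ _).prodMk ((hasDerivAt_add_smul _ _).prodMk
      ((hasDerivAt_add_smul _ _).prodMk (hasDerivAt_add_smul _ _)))))

theorem isVelocity_of_mem_tangentPhase {z v : PhaseAmb} (hz : z ∈ phaseSpace)
    (hv : v ∈ tangentPhase z) : IsVelocity phaseSpace z v := by
  obtain ⟨Ω, V, h⟩ := exists_eq_leftVec hz hv
  rw [h]
  exact isVelocity_leftVec hz _ _ _ _ _ _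

/-- Differentiating `Aᵀ A = 1` along a curve of matrices. -/
theorem transpose_mul_skew_of_hasDerivAt {M : ℝ → Mat3} {M' : Mat3}
    (hM : ∀ i j, HasDerivAt (fun s => M s i j) (M' i j) 0)
    (hO : ∀ t, M t ∈ specialOrthogonalGroup (Fin 3) ℝ) :
    ((M 0)ᵀ * M')ᵀ = -((M 0)ᵀ * M') := by
  have h : M'ᵀ * M 0 + (M 0)ᵀ * M' = 0 := by
    ext i j
    have h1 := hasDerivAt_matrix_mul (M := fun t => (M t)ᵀ) (M' := M'ᵀ)
      (fun i j => hM j i) hM i j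
    simp only [transpose_mul_self (hO _)] at h1
    exact h1.unique (hasDerivAt_const _ _)
  rw [transpose_mul, transpose_transpose]
  exact eq_neg_of_add_eq_zero_left h

theorem IsVelocity.mem_tangentPhase {z v : PhaseAmb} (hv : IsVelocity phaseSpace z v) :
    v ∈ tangentPhase z := by
  obtain ⟨c, rfl, hc, hS⟩ := hv
  exact transpose_mul_skew_of_hasDerivAt (M := fun t => (c t).A)
    (fun i j => hasDerivAt_pi.1 (hasDerivAt_pi.1 hc.fst i) j) hS

theorem IsVelocity.skew_of_config {q v : ConfAmb} (hv : IsVelocity Q q v) :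
    (q.Aᵀ * v.A)ᵀ = -(q.Aᵀ * v.A) := by
  obtain ⟨c, rfl, hc, hS⟩ := hv
  exact transpose_mul_skew_of_hasDerivAt (M := fun t => (c t).A)
    (fun i j => hasDerivAt_pi.1 (hasDerivAt_pi.1 hc.fst i) j) hS

/-! ### The canonical symplectic form in the left trivialization -/

theorem fderiv_canonicalOneForm (z v w : PhaseAmb) :
    fderiv ℝ (fun x => canonicalOneForm x v) z w =
      w.Pi ⬝ᵥ vee (z.Aᵀ * v.A) + z.Pi ⬝ᵥ vee (w.Aᵀ * v.A) + w.Gam ⬝ᵥ (z.Aᵀ *ᵥ v.c) +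
        z.Gam ⬝ᵥ (w.Aᵀ *ᵥ v.c) + w.l * v.al := by
  have hd : DifferentiableAt ℝ (fun x => canonicalOneForm x v) z := by
    simp only [canonicalOneForm, vee, Matrix.mul_apply, mulVec, dotProduct, Fin.sum_univ_three,
      transpose_apply, of_apply, cons_val]
    fun_prop
  have h1 := (hd.hasFDerivAt.comp_hasDerivAt_of_eq (0 : ℝ) (hasDerivAt_add_smul z w) (by simp))
  refine h1.unique ?_
  -- along the line the one-form is a polynomial of degree two in the time
  have h2 : ((fun x => canonicalOneForm x v) ∘ fun t : ℝ => z + t • w) = fun t =>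
      canonicalOneForm z v + t * (w.Pi ⬝ᵥ vee (z.Aᵀ * v.A) + z.Pi ⬝ᵥ vee (w.Aᵀ * v.A) +
        w.Gam ⬝ᵥ (z.Aᵀ *ᵥ v.c) + z.Gam ⬝ᵥ (w.Aᵀ *ᵥ v.c) + w.l * v.al) +
        t ^ 2 * (w.Pi ⬝ᵥ vee (w.Aᵀ * v.A) + w.Gam ⬝ᵥ (w.Aᵀ *ᵥ v.c)) := by
    funext t
    simp [PhaseAmb.Pi, PhaseAmb.Gam, PhaseAmb.l, canonicalOneForm, vee,
      Matrix.mul_apply, mulVec, dotProduct, Fin.sum_univ_three]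
    ring
  rw [h2]
  have h3 := (((hasDerivAt_id (0 : ℝ)).mul_const (w.Pi ⬝ᵥ vee (z.Aᵀ * v.A) +
    z.Pi ⬝ᵥ vee (w.Aᵀ * v.A) + w.Gam ⬝ᵥ (z.Aᵀ *ᵥ v.c) + z.Gam ⬝ᵥ (w.Aᵀ *ᵥ v.c) +
    w.l * v.al)).const_add (canonicalOneForm z v)).fun_add
    ((hasDerivAt_pow 2 (0 : ℝ)).mul_const (w.Pi ⬝ᵥ vee (w.Aᵀ * v.A) + w.Gam ⬝ᵥ (w.Aᵀ *ᵥ v.c)))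
  simpa using h3

/-- The canonical form of `T*Q` on left trivialized vectors. -/
theorem canonicalForm_leftVec {z : PhaseAmb} (hz : z ∈ phaseSpace) (Ω V P G η y P' G' : Vec3)
    (s m s' m' : ℝ) :
    canonicalForm z (leftVec z Ω V P G s m) (leftVec z η y P' G' s' m') =
      pair (P', G') (Ω, V) - pair (P, G) (η, y) + (m' * s - m * s') +
        pair (z.Pi, z.Gam) (bracket (Ω, V) (η, y)) := by
  have h1 : ∀ α β : Vec3, (z.A * hat α)ᵀ * (z.A * hat β) = -(hat α * hat β) := fun α β => by
    rw [transpose_mul, Matrix.mul_assoc, ← Matrix.mul_assoc _ z.A, transpose_mul_self hz,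
      Matrix.one_mul, hat_transpose, Matrix.neg_mul]
  have h2 : ∀ α x : Vec3, (z.A * hat α)ᵀ *ᵥ (z.A *ᵥ x) = -(α ⨯₃ x) := fun α x => by
    rw [mulVec_mulVec, transpose_mul, Matrix.mul_assoc, transpose_mul_self hz, Matrix.mul_one,
      hat_transpose, neg_mulVec, hat_mulVec]
  have h3 : ∀ β : Vec3, z.Aᵀ * (z.A * hat β) = hat β := fun β => by
    rw [← Matrix.mul_assoc, transpose_mul_self hz, Matrix.one_mul]
  have h4 : ∀ x : Vec3, z.Aᵀ *ᵥ (z.A *ᵥ x) = x := fun x => by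
    rw [mulVec_mulVec, transpose_mul_self hz, one_mulVec]
  have h5 : ∀ α : Vec3, (Matrix.of (Matrix.of.symm (z.A * hat α)) : Mat3) = z.A * hat α :=
    fun _ => rfl
  rw [canonicalForm, fderiv_canonicalOneForm, fderiv_canonicalOneForm]
  simp only [leftVec, PhaseAmb.A, PhaseAmb.c, PhaseAmb.Pi, PhaseAmb.Gam, PhaseAmb.al, PhaseAmb.l]
    at h1 h2 h3 h4 h5 ⊢
  simp only [h5, h1, h2, h3, h4, vee_hat]
  simp [pair, bracket, vee, hat, dotProduct, cross_apply, Fin.sum_univ_three]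
  ring

/-- Nondegeneracy of the canonical form on the tangent spaces of `T*Q`. -/
theorem eq_zero_of_canonicalForm_eq_zero {z v : PhaseAmb} (hz : z ∈ phaseSpace)
    (hv : v ∈ tangentPhase z) (h : ∀ w ∈ tangentPhase z, canonicalForm z v w = 0) : v = 0 := by
  obtain ⟨Ω, V, e⟩ := exists_eq_leftVec hz hv
  have test := fun η y P' G' s' m' => h _ (leftVec_mem_tangentPhase hz η y P' G' s' m')
  rw [e] at test ⊢
  simp only [canonicalForm_leftVec hz] at test
  have hself : ∀ x : Vec3, 0 ≤ x ⬝ᵥ x := fun x => by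
    simpa using dotProduct_star_self_nonneg x
  have hpair : ∀ x y : Vec3, pair (x, y) (x, y) = 0 → x = 0 ∧ y = 0 := fun x y hxy => by
    have hx := hself x
    have hy := hself y
    simp only [pair] at hxy
    exact ⟨dotProduct_self_eq_zero.1 (by linarith), dotProduct_self_eq_zero.1 (by linarith)⟩
  obtain ⟨hΩ, hV⟩ := hpair Ω V (by simpa [pair, bracket] using test 0 0 Ω V 0 0)
  subst hΩ hV
  obtain ⟨hP, hG⟩ := hpair v.Pi v.Gam (by
    have h1 := test v.Pi v.Gam 0 0 0 0
    simp only [pair, bracket] at h1 ⊢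
    simp at h1
    linarith)
  have hs : v.al = 0 := by simpa [pair, bracket] using test 0 0 0 0 0 1
  have hl : v.l = 0 := by simpa [pair, bracket] using test 0 0 0 0 1 0
  rw [hP, hG, hs, hl]
  simp [leftVec, hat_zero]

/-! ### Tangent vectors of the reduced space -/

theorem adjugate_eq_transpose {A : Mat3} (hA : A ∈ specialOrthogonalGroup (Fin 3) ℝ) :
    adjugate A = Aᵀ := by
  have hdet : A.det = 1 := (mem_specialOrthogonalGroup_iff.1 hA).2
  calc adjugate A = (Aᵀ * A) * adjugate A := by rw [transpose_mul_self hA, Matrix.one_mul]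
    _ = Aᵀ := by rw [Matrix.mul_assoc, mul_adjugate, hdet, one_smul, Matrix.mul_one]

/-- A matrix turns cross products into cross products through its matrix of cofactors. -/
theorem cross_mulVec_mulVec (A : Mat3) (x y : Vec3) :
    (A *ᵥ x) ⨯₃ (A *ᵥ y) = (adjugate A)ᵀ *ᵥ (x ⨯₃ y) := by
  ext i
  fin_cases i <;>
    simp [adjugate_fin_three, cross_apply, mulVec, dotProduct, Fin.sum_univ_three] <;> ring

theorem transpose_mulVec_cross {A : Mat3} (hA : A ∈ specialOrthogonalGroup (Fin 3) ℝ)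
    (x y : Vec3) : Aᵀ *ᵥ (x ⨯₃ (A *ᵥ y)) = (Aᵀ *ᵥ x) ⨯₃ y := by
  have h : x ⨯₃ (A *ᵥ y) = A *ᵥ ((Aᵀ *ᵥ x) ⨯₃ y) := by
    have h1 := cross_mulVec_mulVec A (Aᵀ *ᵥ x) y
    rwa [mulVec_mulVec, self_mul_transpose hA, one_mulVec, adjugate_eq_transpose hA,
      transpose_transpose] at h1
  rw [h, mulVec_mulVec, transpose_mul_self hA, one_mulVec]

/-- Along `g(t)` with left trivialized velocity `(Ω, V)`, the point `Ad*_{g(t)} ν` of the coadjoint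
orbit has velocity `ad*_(Ω, V) (Ad*_g ν)`. -/
theorem hasDerivAt_coAd {g : Mat3 × Vec3} (hg : g ∈ SE3) (ν ξ : Vec3 × Vec3) :
    HasDerivAt (fun t : ℝ => coAd (g.1 * rot ξ.1 t, g.2 + t • (g.1 *ᵥ ξ.2)) ν)
      (coad ξ (coAd g ν)) 0 := by
  have hM : ∀ i j, HasDerivAt (fun t => ((g.1 * rot ξ.1 t)ᵀ : Mat3) i j)
      ((g.1 * hat ξ.1)ᵀ i j) 0 := fun i j =>
    hasDerivAt_pi.1 (hasDerivAt_pi.1 (hasDerivAt_mul_rot g.1 ξ.1) j) i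
  have hx : HasDerivAt (fun t : ℝ => ν.1 + ν.2 ⨯₃ (g.2 + t • (g.1 *ᵥ ξ.2)))
      (ν.2 ⨯₃ (g.1 *ᵥ ξ.2)) 0 := by
    simp only [map_add, map_smul, ← add_assoc]
    simpa using ((hasDerivAt_id (0 : ℝ)).smul_const (ν.2 ⨯₃ (g.1 *ᵥ ξ.2))).const_add
      (ν.1 + ν.2 ⨯₃ g.2)
  have key : ∀ x : Vec3, (g.1 * hat ξ.1)ᵀ *ᵥ x = (g.1ᵀ *ᵥ x) ⨯₃ ξ.1 := fun x => by
    rw [transpose_mul, ← mulVec_mulVec, hat_transpose, neg_mulVec, hat_mulVec, cross_anticomm]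
  refine HasDerivAt.prodMk ((hasDerivAt_matrix_mulVec hM hx).congr_deriv ?_)
    ((hasDerivAt_matrix_mulVec hM (hasDerivAt_const _ ν.2)).congr_deriv ?_)
  · simp only [rot_zero, Matrix.mul_one, zero_smul, add_zero, key]
    rw [transpose_mulVec_cross hg]
    rfl
  · simp only [rot_zero, Matrix.mul_one, mulVec_zero, add_zero, key]
    rfl

theorem isVelocity_of_mem_tangentReduced {ν : Vec3 × Vec3} {y w : RedAmb}
    (hy : y ∈ reducedSpace ν) (hw : w ∈ tangentReduced y) : IsVelocity (reducedSpace ν) y w := by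
  obtain ⟨g, hg, hgy⟩ := hy
  obtain ⟨ξ, hξ⟩ := hw
  have hc := hasDerivAt_coAd hg ν ξ
  rw [hgy, hξ] at hc
  have hy1 : (coAd g ν).1 = y.Pi := congrArg Prod.fst hgy
  have hy2 : (coAd g ν).2 = y.Gam := congrArg Prod.snd hgy
  refine ⟨fun t => ((coAd (g.1 * rot ξ.1 t, g.2 + t • (g.1 *ᵥ ξ.2)) ν).1,
    (coAd (g.1 * rot ξ.1 t, g.2 + t • (g.1 *ᵥ ξ.2)) ν).2, y.al + t • w.al, y.l + t • w.l),
    ?_, ?_, fun t => ⟨_, mul_mem hg (rot_mem ξ.1 t), rfl⟩⟩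
  · simp only [rot_zero, Matrix.mul_one, zero_smul, add_zero, hy1, hy2]
  · exact HasDerivAt.prodMk hc.fst (HasDerivAt.prodMk hc.snd
      ((hasDerivAt_add_smul _ _).prodMk (hasDerivAt_add_smul _ _)))

/-! ### Reduction of the Hamiltonian vector field -/

/-- The projection `π_Q` as a continuous linear map of the ambient spaces. -/
noncomputable def piQL : PhaseAmb →L[ℝ] ConfAmb :=
  LinearMap.toContinuousLinearMap
    { toFun := piQ, map_add' := fun _ _ => rfl, map_smul' := fun _ _ => rfl }

/-- The reduction projection as a continuous linear map of the ambient spaces. -/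
noncomputable def piRedL : PhaseAmb →L[ℝ] RedAmb :=
  LinearMap.toContinuousLinearMap
    { toFun := piRed, map_add' := fun _ _ => rfl, map_smul' := fun _ _ => rfl }

theorem piRed_mem_reducedSpace {ν : Vec3 × Vec3} {z : PhaseAmb} (hz : z ∈ level ν) :
    piRed z ∈ reducedSpace ν := by
  obtain ⟨hz, rfl⟩ := hz
  refine ⟨(z.A, z.c), hz, ?_⟩
  have h : ∀ x : Vec3, z.Aᵀ *ᵥ (z.A *ᵥ x) = x := fun x => by
    rw [mulVec_mulVec, transpose_mul_self hz, one_mulVec]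
  refine Prod.ext ?_ (h _)
  change z.Aᵀ *ᵥ (z.A *ᵥ z.Pi + z.c ⨯₃ (z.A *ᵥ z.Gam) + (z.A *ᵥ z.Gam) ⨯₃ z.c) = z.Pi
  rw [add_assoc, cross_anticomm', add_zero, h]

theorem pair_injective {κ κ' : Vec3 × Vec3} (h : ∀ η, pair κ η = pair κ' η) : κ = κ' := by
  refine Prod.ext ?_ ?_
  · exact dotProduct_eq_iff.1 fun η => by simpa [pair] using h (η, 0)
  · exact dotProduct_eq_iff.1 fun η => by simpa [pair] using h (0, η)

theorem bracket_anticomm (ξ η : Vec3 × Vec3) : bracket ξ η = -bracket η ξ := by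
  refine Prod.ext ?_ ?_
  · simp [bracket]
  · simp [bracket]

theorem pair_neg (κ ξ : Vec3 × Vec3) : pair κ (-ξ) = -pair κ ξ := by
  simp [pair]; ring

theorem differentiable_reducedHamiltonian (p : Params) :
    Differentiable ℝ (reducedHamiltonian p) := by
  unfold reducedHamiltonian dotProduct
  simp only [Fin.sum_univ_three, div_eq_mul_inv]
  fun_prop

/-- The Hamiltonian field and the reduced Hamiltonian field are related by the reduction
projection. -/
theorem reducedField_piRed {p : Params} {ν : Vec3 × Vec3} {XH : PhaseAmb → PhaseAmb}
    (hXH : IsHamiltonianField (hamiltonian p) XH) {Xh : RedAmb → RedAmb}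
    (hXh : IsReducedHamiltonianField ν (reducedHamiltonian p) Xh) {z : PhaseAmb}
    (hz : z ∈ level ν) : Xh (piRed z) = piRed (XH z) := by
  have hy := piRed_mem_reducedSpace hz
  set D := fderiv ℝ (reducedHamiltonian p) (piRed z)
  have hh : HasFDerivAt (reducedHamiltonian p) D (piRed z) :=
    (differentiable_reducedHamiltonian p _).hasFDerivAt
  have hH : HasFDerivAt (hamiltonian p) (D.comp piRedL) z := hh.comp z piRedL.hasFDerivAt
  obtain ⟨hv, hω⟩ := hXH z hz.1
  obtain ⟨hX, hωr⟩ := hXh _ hy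
  obtain ⟨Ω, V, e⟩ := exists_eq_leftVec hz.1 hv
  set v := XH z
  set X := Xh (piRed z)
  -- the equation of `XH` in the left trivialization
  have full : ∀ η y P' G' s' m',
      pair (P', G') (Ω, V) - pair (v.Pi, v.Gam) (η, y) + (m' * v.al - v.l * s') +
        pair (z.Pi, z.Gam) (bracket (Ω, V) (η, y)) = D (P', G', s', m') := by
    intro η y P' G' s' m'
    have hw := leftVec_mem_tangentPhase hz.1 η y P' G' s' m'
    have h1 := hω _ hw
    rw [(isVelocity_of_mem_tangentPhase hz.1 hw).fderivWithin_apply hH.hasFDerivWithinAt, e,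
      canonicalForm_leftVec hz.1] at h1
    exact h1
  obtain ⟨ζ, hζ⟩ := hX
  have red : ∀ η s' m', -pair (z.Pi, z.Gam) (bracket ζ η) + (m' * X.al - X.l * s') =
      D ((coad η (z.Pi, z.Gam)).1, (coad η (z.Pi, z.Gam)).2, s', m') := by
    intro η s' m'
    have hw : (((coad η (z.Pi, z.Gam)).1, (coad η (z.Pi, z.Gam)).2, s', m') : RedAmb) ∈
        tangentReduced (piRed z) := ⟨η, rfl⟩
    have h1 := hωr _ hw
    rw [(isVelocity_of_mem_tangentReduced hy hw).fderivWithin_apply hh.hasFDerivWithinAt,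
      reducedForm, ← hζ] at h1
    rw [← h1]
    exact congrArg (· + _) (orbitForm_coad _ _ _).symm
  -- testing with vectors tangent to the group factor shows that `v` moves along the orbit
  have hP : (v.Pi, v.Gam) = coad (Ω, V) (z.Pi, z.Gam) := by
    refine pair_injective fun η => ?_
    have h1 := full η.1 η.2 0 0 0 0
    rw [pair_coad]
    have h0 : D (0, 0, 0, 0) = 0 := D.map_zero
    rw [h0] at h1
    simp only [pair, bracket, zero_dotProduct] at h1 ⊢
    linarith
  have agree : ∀ η s' m', -pair (z.Pi, z.Gam) (bracket ζ η) + (m' * X.al - X.l * s') =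
      -pair (z.Pi, z.Gam) (bracket (Ω, V) η) + (m' * v.al - v.l * s') := by
    intro η s' m'
    rw [red, ← full 0 0]
    have h1 : pair (coad η (z.Pi, z.Gam)) (Ω, V) = -pair (z.Pi, z.Gam) (bracket (Ω, V) η) := by
      rw [pair_coad, bracket_anticomm, pair_neg]
    rw [← h1]
    simp [pair, bracket]
  have hcoad : coad ζ (z.Pi, z.Gam) = coad (Ω, V) (z.Pi, z.Gam) := by
    refine pair_injective fun η => ?_
    rw [pair_coad, pair_coad]
    have := agree η 0 0
    linarith
  have h0 := agree 0 0 0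
  have hal : X.al = v.al := by
    have := agree 0 0 1
    linarith
  have hl : X.l = v.l := by
    have := agree 0 1 0
    linarith
  replace hcoad : (X.Pi, X.Gam) = (v.Pi, v.Gam) := hζ.symm.trans (hcoad.trans hP.symm)
  obtain ⟨hPi, hGam⟩ := Prod.mk.inj hcoad
  exact Prod.ext hPi (Prod.ext hGam (Prod.ext hal hl))

/-! ### The base component of the controlled field -/

theorem eq_of_piQ_eq_of_piRed_eq {z z' : PhaseAmb} (h1 : piQ z = piQ z')
    (h2 : piRed z = piRed z') : z = z' := by
  simp only [piQ, piRed, Prod.mk.injEq] at h1 h2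
  exact Prod.ext h1.1 (Prod.ext h1.2.1 (Prod.ext h2.1 (Prod.ext h2.2.1
    (Prod.ext h2.2.2.1 h2.2.2.2))))

theorem vertical_subset_tangentPhase (z : PhaseAmb) : vertical ⊆ tangentPhase z := by
  intro v hv
  have h : v.1 = 0 := congrArg Prod.fst (show piQ v = 0 from hv)
  have hA : v.A = 0 := by rw [PhaseAmb.A, h]; rfl
  change (z.Aᵀ * v.A)ᵀ = -(z.Aᵀ * v.A)
  simp [hA]

theorem add_mem_tangentPhase {z v w : PhaseAmb} (hv : v ∈ tangentPhase z)
    (hw : w ∈ tangentPhase z) : v + w ∈ tangentPhase z := by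
  change (z.Aᵀ * (v.A + w.A))ᵀ = -(z.Aᵀ * (v.A + w.A))
  rw [Matrix.mul_add, transpose_add, hv, hw, neg_add]

theorem hasFDerivWithinAt_fderivWithin {E F : Type*} [NormedAddCommGroup E] [NormedSpace ℝ E]
    [NormedAddCommGroup F] [NormedSpace ℝ F] {f : E → F} {S : Set E} (hf : ContDiffOn ℝ ∞ f S)
    {x : E} (hx : x ∈ S) : HasFDerivWithinAt f (fderivWithin ℝ f S x) S x :=
  (hf.differentiableOn (by simp) x hx).hasFDerivWithinAt

theorem vlift_mem_vertical {ν : Vec3 × Vec3} {K : PhaseAmb → PhaseAmb →ₗ[ℝ] PhaseAmb}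
    (hK : IsVerticalProjection K) {u : PhaseAmb → PhaseAmb} (hu : IsReducibleControl ν u)
    {X : PhaseAmb → PhaseAmb} {z : PhaseAmb} (hz : z ∈ phaseSpace) (hX : X z ∈ tangentPhase z) :
    vlift K u X z ∈ vertical := by
  have hmaps : MapsTo u phaseSpace phaseSpace := fun x hx => by
    have h := hu.fibre x hx
    simp only [piQ, Prod.mk.injEq] at h
    change (u x).A ∈ specialOrthogonalGroup (Fin 3) ℝ
    rw [PhaseAmb.A, h.1]
    exact hx
  have hv := (isVelocity_of_mem_tangentPhase hz hX).map
    (hasFDerivWithinAt_fderivWithin hu.smooth hz) hmaps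
  exact (hK _ (hmaps hz)).1 _ hv.mem_tangentPhase

/-- The vertical lift of the control does not contribute to the base component of the controlled
field. -/
theorem configField_controlledField {ν : Vec3 × Vec3} {XH : PhaseAmb → PhaseAmb}
    {K : PhaseAmb → PhaseAmb →ₗ[ℝ] PhaseAmb} (hK : IsVerticalProjection K)
    {u : PhaseAmb → PhaseAmb} (hu : IsReducibleControl ν u) {ε : PhaseAmb → PhaseAmb}
    {z : PhaseAmb} (hz : ε z ∈ phaseSpace) (hX : XH (ε z) ∈ tangentPhase (ε z)) :
    configField (controlledField K u XH) ε z = (piQ (ε z), piQ (XH (ε z))) := by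
  have hvert := vlift_mem_vertical hK hu hz hX
  have ht := add_mem_tangentPhase hX (vertical_subset_tangentPhase _ hvert)
  refine Prod.ext rfl ?_
  change fderivWithin ℝ piQL phaseSpace (ε z) (XH (ε z) + vlift K u XH (ε z)) = piQ (XH (ε z))
  rw [(isVelocity_of_mem_tangentPhase hz ht).fderivWithin_apply piQL.hasFDerivWithinAt, map_add]
  have : piQL (vlift K u XH (ε z)) = 0 := hvert
  rw [this, add_zero]
  rfl

theorem mapsTo_piQ : MapsTo piQL phaseSpace Q := fun _ h => h

/-- The pointwise equivalence of the two Hamilton–Jacobi equations. The components along `π_Q` of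
the first equation hold because `γ` is a section, the others are the second equation. -/
theorem typeIIAt_iff_reducedTypeIIAt {p : Params} {ν : Vec3 × Vec3} {XH : PhaseAmb → PhaseAmb}
    (hXH : IsHamiltonianField (hamiltonian p) XH) {Xh : RedAmb → RedAmb}
    (hXh : IsReducedHamiltonianField ν (reducedHamiltonian p) Xh)
    {K : PhaseAmb → PhaseAmb →ₗ[ℝ] PhaseAmb} (hK : IsVerticalProjection K)
    {u : PhaseAmb → PhaseAmb} (hu : IsReducibleControl ν u)
    {γ : ConfAmb → PhaseAmb} (hγ : IsReducibleOneForm ν γ)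
    {ε : PhaseAmb → PhaseAmb} {z : PhaseAmb} (hz : ε z ∈ level ν) :
    TypeIIAt XH (controlledField K u XH) γ ε z ↔
      ReducedTypeIIAt Xh (controlledField K u XH) γ ε z := by
  have hX := (hXH _ hz.1).1
  rw [TypeIIAt, ReducedTypeIIAt, configField_controlledField hK hu hz.1 hX, Function.comp_apply,
    reducedField_piRed hXH hXh hz]
  set x := ε z
  set q := piQ x
  have hq : q ∈ Q := hz.1
  have hv : IsVelocity Q q (piQ (XH x)) :=
    (isVelocity_of_mem_tangentPhase hz.1 hX).map piQL.hasFDerivWithinAt mapsTo_piQ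
  have hγ' := hasFDerivWithinAt_fderivWithin hγ.smooth hq
  -- `π_Q ∘ γ` is the identity of `Q`, hence so is its derivative on tangent vectors
  have hsec : piQL (fderivWithin ℝ γ Q q (piQ (XH x))) = piQ (XH x) :=
    hv.fderiv_unique (piQL.hasFDerivAt.comp_hasFDerivWithinAt q hγ')
      ((hasFDerivWithinAt_id q Q).congr hγ.isSection (hγ.isSection q hq))
  have hred : fderivWithin ℝ (piRed ∘ γ) Q q (piQ (XH x)) =
      piRed (fderivWithin ℝ γ Q q (piQ (XH x))) :=
    hv.fderivWithin_apply (piRedL.hasFDerivAt.comp_hasFDerivWithinAt q hγ')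
  simp only [tmap, hred, Prod.mk.injEq, Function.comp_apply]
  constructor
  · rintro ⟨h1, h2⟩
    rw [h1, h2]
    exact ⟨rfl, rfl⟩
  · rintro ⟨h1, h2⟩
    exact ⟨eq_of_piQ_eq_of_piRed_eq (hγ.isSection q hq) h1, eq_of_piQ_eq_of_piRed_eq hsec h2⟩

/-! ### A symplectic map does not send a level set into the image of a one-form -/

theorem mem_level_coAd {g : Mat3 × Vec3} (hg : g ∈ SE3) (ν : Vec3 × Vec3) (s m : ℝ) :
    ((Matrix.of.symm g.1, g.2, (coAd g ν).1, (coAd g ν).2, s, m) : PhaseAmb) ∈ level ν := by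
  have h : ∀ y : Vec3, g.1 *ᵥ (g.1ᵀ *ᵥ y) = y := fun y => by
    rw [mulVec_mulVec, self_mul_transpose hg, one_mulVec]
  refine ⟨hg, ?_⟩
  change (g.1 *ᵥ (g.1ᵀ *ᵥ (ν.1 + ν.2 ⨯₃ g.2)) + g.2 ⨯₃ (g.1 *ᵥ (g.1ᵀ *ᵥ ν.2)),
    g.1 *ᵥ (g.1ᵀ *ᵥ ν.2)) = ν
  rw [h, h, add_assoc, cross_anticomm', add_zero]

/-- The point of `J_Q⁻¹ (ν)` over the identity of `SE(3) × ℝ` with vanishing rotor momentum. -/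
def levelPoint (ν : Vec3 × Vec3) : PhaseAmb := (Matrix.of.symm 1, 0, ν.1, ν.2, 0, 0)

theorem levelPoint_mem (ν : Vec3 × Vec3) : levelPoint ν ∈ level ν := by
  refine ⟨show (1 : Mat3) ∈ specialOrthogonalGroup (Fin 3) ℝ from one_mem _, ?_⟩
  change ((1 : Mat3) *ᵥ ν.1 + 0 ⨯₃ ((1 : Mat3) *ᵥ ν.2), (1 : Mat3) *ᵥ ν.2) = ν
  simp

theorem hat_add (x y : Vec3) : hat (x + y) = hat x + hat y := by
  ext i j; fin_cases i <;> fin_cases j <;> simp [hat] <;> ring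

theorem hat_smul (r : ℝ) (x : Vec3) : hat (r • x) = r • hat x := by
  ext i j; fin_cases i <;> fin_cases j <;> simp [hat]

/-- The tangent vectors of `J_Q⁻¹ (ν)` at `levelPoint ν`, parametrized by the velocity in
`se(3)` and those of `α` and `l`. -/
def levelTangent (ν : Vec3 × Vec3) : (Vec3 × Vec3 × ℝ × ℝ) →ₗ[ℝ] PhaseAmb where
  toFun x := leftVec (levelPoint ν) x.1 x.2.1 (coad (x.1, x.2.1) ν).1 (coad (x.1, x.2.1) ν).2
    x.2.2.1 x.2.2.2
  map_add' x y := by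
    simp only [leftVec, coad, Prod.fst_add, Prod.snd_add, hat_add, mulVec_add, Matrix.mul_add,
      map_add, Prod.mk_add_mk]
    refine Prod.ext rfl (Prod.ext rfl (Prod.ext ?_ rfl))
    change _ + _ + (_ + _) = _ + _ + (_ + _)
    abel
  map_smul' r x := by
    simp only [leftVec, coad, Prod.smul_fst, Prod.smul_snd, hat_smul, mulVec_smul,
      Matrix.mul_smul, map_smul, Prod.smul_mk, smul_add, RingHom.id_apply]
    rfl

theorem levelTangent_injective (ν : Vec3 × Vec3) : Function.Injective (levelTangent ν) := by
  intro x y h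
  change leftVec _ _ _ _ _ _ _ = leftVec _ _ _ _ _ _ _ at h
  simp only [leftVec, Prod.mk.injEq, Matrix.of.symm.injective.eq_iff] at h
  have hA : (levelPoint ν).A = 1 := rfl
  rw [hA] at h
  simp only [Matrix.one_mul, one_mulVec] at h
  obtain ⟨h1, h2, -, -, h3, h4⟩ := h
  have h1' : x.1 = y.1 := by rw [← vee_hat x.1, h1, vee_hat]
  exact Prod.ext h1' (Prod.ext h2 (Prod.ext h3 h4))

theorem isVelocity_levelTangent (ν : Vec3 × Vec3) (x : Vec3 × Vec3 × ℝ × ℝ) :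
    IsVelocity (level ν) (levelPoint ν) (levelTangent ν x) := by
  have hone : (1 : Mat3) ∈ specialOrthogonalGroup (Fin 3) ℝ := one_mem _
  have hc : HasDerivAt
      (fun t : ℝ => coAd ((1 : Mat3) * rot x.1 t, (0 : Vec3) + t • ((1 : Mat3) *ᵥ x.2.1)) ν)
      (coad (x.1, x.2.1) (coAd ((1 : Mat3), (0 : Vec3)) ν)) 0 :=
    hasDerivAt_coAd (g := ((1 : Mat3), (0 : Vec3))) hone ν (x.1, x.2.1)
  have h1 : coAd ((1 : Mat3), (0 : Vec3)) ν = ν := by simp [coAd]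
  rw [h1] at hc
  refine ⟨fun t => (Matrix.of.symm (1 * rot x.1 t), 0 + t • ((1 : Mat3) *ᵥ x.2.1),
    (coAd (1 * rot x.1 t, 0 + t • ((1 : Mat3) *ᵥ x.2.1)) ν).1,
    (coAd (1 * rot x.1 t, 0 + t • ((1 : Mat3) *ᵥ x.2.1)) ν).2,
    0 + t • x.2.2.1, 0 + t • x.2.2.2), ?_, ?_,
    fun t => mem_level_coAd (g := (1 * rot x.1 t, 0 + t • ((1 : Mat3) *ᵥ x.2.1)))
      (show 1 * rot x.1 t ∈ specialOrthogonalGroup (Fin 3) ℝ from mul_mem hone (rot_mem _ _))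
      ν _ _⟩
  · simp [rot_zero, levelPoint, coAd]
  · exact (hasDerivAt_mul_rot 1 x.1).prodMk ((hasDerivAt_add_smul _ _).prodMk
      (HasDerivAt.prodMk hc.fst (HasDerivAt.prodMk hc.snd
      ((hasDerivAt_add_smul _ _).prodMk (hasDerivAt_add_smul _ _)))))

/-- Left trivialization of `T_q Q`, defined on all ambient vectors. -/
noncomputable def trivQ (q : ConfAmb) : ConfAmb →ₗ[ℝ] Vec3 × Vec3 × ℝ where
  toFun v := (vee (q.Aᵀ * v.A), v.c, v.al)
  map_add' v w := by
    have : vee (q.Aᵀ * (v + w).A) = vee (q.Aᵀ * v.A) + vee (q.Aᵀ * w.A) := by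
      change vee (q.Aᵀ * (v.A + w.A)) = _
      rw [Matrix.mul_add]
      ext i; fin_cases i <;> simp [vee] <;> ring
    rw [this]
    rfl
  map_smul' r v := by
    have : vee (q.Aᵀ * (r • v).A) = r • vee (q.Aᵀ * v.A) := by
      change vee (q.Aᵀ * (r • v.A)) = _
      rw [Matrix.mul_smul]
      ext i; fin_cases i <;> simp [vee] <;> ring
    rw [this]
    rfl

theorem eq_zero_of_trivQ_eq_zero {q v : ConfAmb} (hq : q ∈ Q) (hv : IsVelocity Q q v)
    (h : trivQ q v = 0) : v = 0 := by
  obtain ⟨h1, h3⟩ := Prod.mk.inj (show (vee (q.Aᵀ * v.A), v.2) = (0, 0) from h)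
  have h2 : v.A = 0 := by
    rw [← Matrix.one_mul v.A, ← self_mul_transpose hq, Matrix.mul_assoc,
      ← hat_vee hv.skew_of_config, h1]
    rw [hat_zero, Matrix.mul_zero]
  exact Prod.ext h2 h3

/-- The level set of the momentum map has dimension `8` and the image of a section of `T*Q` has
dimension `7`, while a symplectic map is an immersion. -/
theorem exists_level_section_ne {ν : Vec3 × Vec3} {γ : ConfAmb → PhaseAmb}
    (hγ : IsReducibleOneForm ν γ) {ε : PhaseAmb → PhaseAmb}
    (hε : IsReducibleSymplecticMap ν ε) : ∃ z ∈ level ν, γ (piQ (ε z)) ≠ ε z := by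
  by_contra! hall
  set z := levelPoint ν
  have hz : z ∈ level ν := levelPoint_mem ν
  set F := fderivWithin ℝ ε phaseSpace z
  have hF : HasFDerivWithinAt ε F phaseSpace z := hasFDerivWithinAt_fderivWithin hε.smooth hz.1
  have hsub : level ν ⊆ phaseSpace := fun _ h => h.1
  have hq : piQ (ε z) ∈ Q := hε.mapsTo hz.1
  -- a nonzero vector tangent to the level set whose image under `T (π_Q ∘ ε)` vanishes
  obtain ⟨x, hx, hx0⟩ : ∃ x, trivQ (piQ (ε z)) (piQL (F (levelTangent ν x))) = 0 ∧ x ≠ 0 := by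
    have hker := LinearMap.ker_ne_bot_of_finrank_lt
      (f := trivQ (piQ (ε z)) ∘ₗ piQL.toLinearMap ∘ₗ F.toLinearMap ∘ₗ levelTangent ν)
      (by simp)
    obtain ⟨x, hx, hx0⟩ := (Submodule.ne_bot_iff _).1 hker
    exact ⟨x, hx, hx0⟩
  have hvel := isVelocity_levelTangent ν x
  have hvel' : IsVelocity phaseSpace z (levelTangent ν x) := by
    obtain ⟨c, h0, hc, hS⟩ := hvel
    exact ⟨c, h0, hc, fun t => hsub (hS t)⟩
  have hbase : piQL (F (levelTangent ν x)) = 0 :=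
    eq_zero_of_trivQ_eq_zero hq
      ((hvel'.map hF hε.mapsTo).map piQL.hasFDerivWithinAt mapsTo_piQ) hx
  -- `ε` agrees with `γ ∘ π_Q ∘ ε` on the level set, so `T ε` annihilates the vector as well
  have hzero : F (levelTangent ν x) = 0 := by
    have h1 : HasFDerivWithinAt ε (fderivWithin ℝ γ Q (piQ (ε z)) ∘L piQL ∘L F) (level ν) z :=
      (HasFDerivWithinAt.comp z (hasFDerivWithinAt_fderivWithin hγ.smooth hq)
        (piQL.hasFDerivAt.comp_hasFDerivWithinAt z (hF.mono hsub))
        (fun y hy => hε.mapsTo hy.1)).congr (fun y hy => (hall y hy).symm) (hall z hz).symm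
    rw [hvel.fderiv_unique (hF.mono hsub) h1]
    simp [hbase]
  refine hx0 (levelTangent_injective ν ?_)
  rw [map_zero]
  refine eq_zero_of_canonicalForm_eq_zero hz.1 hvel'.mem_tangentPhase fun w hw => ?_
  have hsymp := hε.symplectic z hz.1 _ hvel'.mem_tangentPhase w hw
  rw [← hsymp]
  have hzero' : (tmap ε phaseSpace (z, levelTangent ν x)).2 = 0 := hzero
  rw [hzero', canonicalForm, fderiv_canonicalOneForm, fderiv_canonicalOneForm]
  have hA : (0 : PhaseAmb).A = 0 := rfl
  have hvee : vee 0 = 0 := by ext i; fin_cases i <;> simp [vee]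
  simp [hA, PhaseAmb.Pi, PhaseAmb.Gam, PhaseAmb.c, PhaseAmb.al, PhaseAmb.l, hvee]

end SpacecraftRotor

theorem theorem4p7 (p : Params) (μ a : Vec3)
    -- the Hamiltonian vector fields of the system and of the reduced system
    (XH : PhaseAmb → PhaseAmb) (hXH : IsHamiltonianField (hamiltonian p) XH)
    (Xh : RedAmb → RedAmb) (hXh : IsReducedHamiltonianField (μ, a) (reducedHamiltonian p) Xh)
    -- the control torque and the connection that defines its vertical lift
    (K : PhaseAmb → PhaseAmb →ₗ[ℝ] PhaseAmb) (hK : IsVerticalProjection K)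
    (u : PhaseAmb → PhaseAmb) (hu : IsReducibleControl (μ, a) u)
    (γ : ConfAmb → PhaseAmb) (hγ : IsReducibleOneForm (μ, a) γ)
    (ε : PhaseAmb → PhaseAmb) (hε : IsReducibleSymplecticMap (μ, a) ε) :
    -- the two equations are equivalent at every point of the level set
    (∀ z ∈ level (μ, a),
      TypeIIAt XH (controlledField K u XH) γ ε z ↔
        ReducedTypeIIAt Xh (controlledField K u XH) γ ε z) ∧
    -- and as equations between maps on `T*Q` and on the level set
    ((∀ z ∈ phaseSpace, TypeIIAt XH (controlledField K u XH) γ ε z) ↔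
      ∀ z ∈ level (μ, a), ReducedTypeIIAt Xh (controlledField K u XH) γ ε z) := by
  have pointwise : ∀ z ∈ level (μ, a), TypeIIAt XH (controlledField K u XH) γ ε z ↔
      ReducedTypeIIAt Xh (controlledField K u XH) γ ε z := fun z hz =>
    typeIIAt_iff_reducedTypeIIAt hXH hXh hK hu hγ (hε.mapsLevel hz)
  refine ⟨pointwise, fun h z hz => (pointwise z hz).1 (h z hz.1), fun h => ?_⟩
  -- the foot points of the reduced equation force `ε = γ ∘ π_Q ∘ ε` on the whole level set
  obtain ⟨z, hz, hne⟩ := exists_level_section_ne hγ hε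
  exact absurd (congrArg Prod.fst ((pointwise z hz).2 (h z hz))) hne
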